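/- Work over $\mathbb{C}$. For points $p_1,\dots,p_k\in\mathbb{P}^2$ and non-negative integers $d,m$, let $\mathcal{L}(d;mp_1,\dots,mp_k)$ be the linear system of plane curves of degree $d$ having multiplicity at least $m$ at each $p_i$. Let $d\ge 0$ and $m\ge 1$ be integers with $d/m\le 3$. Then there is a nonempty Zariski open subset $U\subseteq(\mathbb{P}^2)^{10}$ (depending on $d$ and $m$) such that for every $(p_1,\dots,p_{10})\in U$: (a) $\mathcal{L}(d;mp_1,\dots,mp_{10})$ is empty (that is, $\mathcal{L}(d;m^{10})$ is empty for ten general points); (b) for every $j\in\{1,\dots,10\}$ there is exactly one plane cubic $C_j$ through the nine points $p_i$, $i\ne j$; it does not pass through $p_j$; and the linear system of curves of degree $d$ with multiplicity at least $m$ at these nine points is empty if $d<3m$, and consists of the single curve $mC_j$ if $d=3m$. -/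

import Mathlib

namespace PlaneCurves

open MvPolynomial

/-- The complex projective plane: lines through the origin in `ℂ³`. -/
abbrev Plane : Type := Projectivization ℂ (Fin 3 → ℂ)

/-- The Taylor expansion `F(v + X)` of a polynomial `F` at a vector `v` of `ℂ³`. -/
noncomputable def taylorAt (v : Fin 3 → ℂ) :
    MvPolynomial (Fin 3) ℂ →ₐ[ℂ] MvPolynomial (Fin 3) ℂ :=
  aeval (fun i => X i + C (v i))

/-- The plane curve `F = 0` has multiplicity at least `m` at the point `p`: the expansion of `F`
at a representative of `p` has no term of degree less than `m`. For a form `F` the choice of the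
representative is irrelevant, and the order of `F` at it is the order at `p` of the local equation
of the curve in any affine chart, because `F` is that local equation times a power of a linear
form not vanishing at `p`. -/
def HasMultGE (F : MvPolynomial (Fin 3) ℂ) (p : Plane) (m : ℕ) : Prop :=
  ∀ e : Fin 3 →₀ ℕ, e.degree < m → coeff e (taylorAt p.rep F) = 0

/-- The vector space of forms of degree `d` (together with `0`) that have multiplicity at least
`m i` at `p i` for every `i`. -/
noncomputable def forms {k : ℕ} (d : ℕ) (m : Fin k → ℕ) (p : Fin k → Plane) :
    Submodule ℂ (MvPolynomial (Fin 3) ℂ) where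
  carrier := {F | F.IsHomogeneous d ∧ ∀ i, HasMultGE F (p i) (m i)}
  zero_mem' := ⟨isHomogeneous_zero _ _ _, fun i e _ => by simp⟩
  add_mem' := fun hF hG => ⟨hF.1.add hG.1, fun i e he => by
    rw [map_add, coeff_add, hF.2 i e he, hG.2 i e he, add_zero]⟩
  smul_mem' := fun c F hF => ⟨(homogeneousSubmodule (Fin 3) ℂ d).smul_mem c hF.1, fun i e he => by
    rw [map_smul, coeff_smul, hF.2 i e he, smul_zero]⟩

/-- The linear system `𝓛(d; m₁ p₁, …, mₖ pₖ)` of plane curves of degree `d` with multiplicity at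
least `m i` at `p i`: nonzero forms as above, up to nonzero scalars. -/
abbrev LinearSystem {k : ℕ} (d : ℕ) (m : Fin k → ℕ) (p : Fin k → Plane) : Type :=
  Projectivization ℂ (forms d m p)

/-- `G`, a polynomial in `k` groups of three variables, is homogeneous in each group. -/
def IsMultihomogeneous {k : ℕ} (G : MvPolynomial (Fin k × Fin 3) ℂ) : Prop :=
  ∀ i : Fin k, ∃ a : ℕ, G.IsWeightedHomogeneous (fun q => if q.1 = i then (1 : ℕ) else 0) a

/-- Zariski open subsets of `(ℙ²)ᵏ`: complements of the common zero loci of families of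
multihomogeneous polynomials. -/
def IsZariskiOpen {k : ℕ} (U : Set (Fin k → Plane)) : Prop :=
  ∃ S : Set (MvPolynomial (Fin k × Fin 3) ℂ), (∀ G ∈ S, IsMultihomogeneous G) ∧
    Uᶜ = {p | ∀ G ∈ S, eval (fun q => (p q.1).rep q.2) G = 0}

/-- `P` holds for `k` general points of the plane: it holds on a nonempty (hence dense) Zariski
open subset of `(ℙ²)ᵏ`. -/
def ForGeneralPoints (k : ℕ) (P : (Fin k → Plane) → Prop) : Prop :=
  ∃ U : Set (Fin k → Plane), IsZariskiOpen U ∧ U.Nonempty ∧ ∀ p ∈ U, P p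

end PlaneCurves

/-!
For ten points `p` and an index `j`, consider the curves of degree `3m` that have multiplicity `m`
at the nine points other than `p j` and pass through `p j`. If there is no such curve, then the
value at `p j` is an injective functional on the forms of degree `3m` with multiplicity `m` at the
nine points. Since `m`-th powers of cubics through the nine points are such forms, the value at
`p j` is injective on these cubics as well, and everything claimed about `p` and `j` follows
(`exists_cubic_of_forms_insertNth_eq_bot`); curves of degree `d < 3m` are brought to degree `3m` by
a power of a line through `p j`.

The absence of curves with prescribed degree and multiplicities is the non-vanishing of some
maximal minor of the matrix of Taylor coefficients of monomials, and such a minor is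
multihomogeneous in the points. So it holds at general points as soon as it holds at one
configuration, and simultaneously for all `j` because a product of nonzero polynomials is nonzero
(`forGeneralPoints_forms_eq_bot`).

The configuration consists of nine smooth points `(t : 1 : t³)` on the cuspidal cubic `x³ = y²z`,
with `∑ t ≠ 0`, and of a point off the cubic. If a form `F` of degree `3m` has multiplicity `m` at
the nine points, then `F(t, 1, t³)` has degree at most `9m` and is divisible by `∏ (t - tᵢ)ᵐ`, so
that it is a constant multiple of this product. It has no term of degree `9m - 1`, so the constant
is zero, because the coefficient there is `-m ∑ tᵢ` (`cuspRestrict_eq_zero`). Hence the cubic divides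
`F`, and the quotient has degree `3(m - 1)` and multiplicity `m - 1` at the nine points. By
induction, `F` is a multiple of the `m`-th power of the cubic (`exists_eq_C_mul_cuspForm_pow`),
and this does not pass through the tenth point. -/

namespace PlaneCurves

open MvPolynomial

/-! ### Multiplicities -/

theorem hasMultGE_iff_le_order {F : MvPolynomial (Fin 3) ℂ} {p : Plane} {m : ℕ} :
    HasMultGE F p m ↔ (m : ℕ∞) ≤ (taylorAt p.rep F : MvPowerSeries (Fin 3) ℂ).order := by
  constructor
  · intro h
    exact MvPowerSeries.nat_le_order fun e he => by rw [coeff_coe]; exact h e he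
  · intro h e he
    rw [← coeff_coe]
    exact MvPowerSeries.coeff_of_lt_order (lt_of_lt_of_le (by exact_mod_cast he) h)

theorem HasMultGE.mono {F : MvPolynomial (Fin 3) ℂ} {p : Plane} {m n : ℕ} (h : HasMultGE F p m)
    (hn : n ≤ m) : HasMultGE F p n :=
  fun e he => h e (he.trans_le hn)

theorem HasMultGE.mul {F G : MvPolynomial (Fin 3) ℂ} {p : Plane} {m n : ℕ}
    (hF : HasMultGE F p m) (hG : HasMultGE G p n) : HasMultGE (F * G) p (m + n) := by
  rw [hasMultGE_iff_le_order] at *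
  rw [map_mul, coe_mul, MvPowerSeries.order_mul, Nat.cast_add]
  exact add_le_add hF hG

theorem HasMultGE.pow {F : MvPolynomial (Fin 3) ℂ} {p : Plane} {m : ℕ}
    (hF : HasMultGE F p m) (n : ℕ) : HasMultGE (F ^ n) p (n * m) := by
  induction n with
  | zero => intro e he; simp at he
  | succ n ih => rw [pow_succ, add_mul, one_mul]; exact ih.mul hF

/-- Orders of vanishing add up, so dividing by a curve of multiplicity at most one lowers the
multiplicity by at most one. -/
theorem HasMultGE.of_mul_left {F G : MvPolynomial (Fin 3) ℂ} {p : Plane} {m : ℕ}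
    (hF : ¬ HasMultGE F p 2) (h : HasMultGE (F * G) p (m + 1)) : HasMultGE G p m := by
  rw [hasMultGE_iff_le_order] at *
  rw [map_mul, coe_mul, MvPowerSeries.order_mul] at h
  by_contra hG
  rw [not_le] at hF hG
  generalize MvPowerSeries.order (taylorAt p.rep F : MvPowerSeries (Fin 3) ℂ) = a at *
  generalize MvPowerSeries.order (taylorAt p.rep G : MvPowerSeries (Fin 3) ℂ) = b at *
  lift a to ℕ using hF.ne_top
  lift b to ℕ using hG.ne_top
  norm_cast at *
  omega

theorem hasMultGE_one_iff {F : MvPolynomial (Fin 3) ℂ} {p : Plane} :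
    HasMultGE F p 1 ↔ eval p.rep F = 0 := by
  have key : coeff 0 (taylorAt p.rep F) = eval p.rep F := by
    have : (constantCoeff : MvPolynomial (Fin 3) ℂ →+* ℂ).comp
        (taylorAt p.rep).toRingHom = eval p.rep := by
      ext i <;> simp [taylorAt]
    exact DFunLike.congr_fun this F
  rw [← key]
  constructor
  · intro h; exact h 0 (by simp)
  · intro h e he
    have : e = 0 := (Finsupp.degree_eq_zero_iff e).1 (Nat.lt_one_iff.1 he)
    rw [this, h]

/-- A polynomial without terms of degree less than `m` is divisible by `s ^ m` after substituting
multiples of `s` for the variables. -/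
theorem pow_dvd_aeval_mul {σ A : Type*} [Fintype σ] [CommRing A] [Algebra ℂ A]
    {P : MvPolynomial σ ℂ} {m : ℕ} (hP : ∀ e : σ →₀ ℕ, e.degree < m → coeff e P = 0)
    (s : A) (g : σ → A) : s ^ m ∣ aeval (fun i => s * g i) P := by
  rw [aeval_def, eval₂_eq']
  refine Finset.dvd_sum fun e he => Dvd.dvd.mul_left ?_ _
  have hm : m ≤ e.degree := by
    by_contra h
    exact (mem_support_iff.1 he) (hP e (not_le.1 h))
  simp_rw [mul_pow]
  rw [Finset.prod_mul_distrib, Finset.prod_pow_eq_pow_sum, ← Finsupp.degree_eq_sum]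
  exact (pow_dvd_pow s hm).mul_right _

theorem aeval_const_mul_of_isHomogeneous {σ A : Type*} [Fintype σ] [CommRing A] [Algebra ℂ A]
    {F : MvPolynomial σ ℂ} {d : ℕ} (hF : F.IsHomogeneous d) (c : A) (f : σ → A) :
    aeval (fun i => c * f i) F = c ^ d * aeval f F := by
  rw [aeval_def, aeval_def, eval₂_eq', eval₂_eq', Finset.mul_sum]
  refine Finset.sum_congr rfl fun e he => ?_
  have hd : e.degree = d := by
    by_contra h
    exact (mem_support_iff.1 he) (hF.coeff_eq_zero h)
  simp_rw [mul_pow]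
  rw [Finset.prod_mul_distrib, Finset.prod_pow_eq_pow_sum, ← Finsupp.degree_eq_sum, hd]
  ring

theorem aeval_taylorAt {A : Type*} [CommRing A] [Algebra ℂ A] (v : Fin 3 → ℂ) (f : Fin 3 → A)
    (F : MvPolynomial (Fin 3) ℂ) :
    aeval f (taylorAt v F) = aeval (fun i => f i + algebraMap ℂ A (v i)) F := by
  have : (aeval f).comp (taylorAt v) =
      (aeval (fun i => f i + algebraMap ℂ A (v i)) : MvPolynomial (Fin 3) ℂ →ₐ[ℂ] A) := by
    ext i; simp [taylorAt]
  exact DFunLike.congr_fun this F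

/-- A form that is the product of a nonzero form and a polynomial has a form as cofactor. -/
theorem exists_isHomogeneous_eq_mul_of_dvd {F G : MvPolynomial (Fin 3) ℂ} {a b : ℕ}
    (hF : F.IsHomogeneous (a + b)) (hG : G.IsHomogeneous a) (h : G ∣ F) :
    ∃ Q : MvPolynomial (Fin 3) ℂ, Q.IsHomogeneous b ∧ F = G * Q := by
  obtain ⟨Q, rfl⟩ := h
  let _ : GradedAlgebra (homogeneousSubmodule (Fin 3) ℂ) := MvPolynomial.gradedAlgebra
  have := DirectSum.coe_decompose_mul_add_of_left_mem (homogeneousSubmodule (Fin 3) ℂ) (j := b)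
    (b := Q) hG
  rw [DirectSum.decompose_of_mem_same _ hF] at this
  exact ⟨_, (DirectSum.decompose (homogeneousSubmodule (Fin 3) ℂ) Q b).2, this⟩

/-! ### The cuspidal cubic -/

/-- The form `x³ - y²z`, which defines a cuspidal cubic. -/
noncomputable def cuspForm : MvPolynomial (Fin 3) ℂ := X 0 ^ 3 - X 1 ^ 2 * X 2

/-- Restriction of polynomials to the parametrization `t ↦ (t, 1, t³)` of the smooth points of
the cuspidal cubic. -/
noncomputable def cuspRestrict : MvPolynomial (Fin 3) ℂ →ₐ[ℂ] Polynomial ℂ :=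
  aeval ![Polynomial.X, 1, Polynomial.X ^ 3]

/-- The smooth point `(t : 1 : t³)` of the cuspidal cubic. -/
noncomputable def cuspPoint (t : ℂ) : Plane :=
  Projectivization.mk ℂ ![t, 1, t ^ 3] fun h => one_ne_zero (congrFun h 1)

theorem exists_cuspPoint_rep (t : ℂ) :
    ∃ a : ℂ, a ≠ 0 ∧ (cuspPoint t).rep = ![a * t, a, a * t ^ 3] := by
  obtain ⟨a, ha⟩ := Projectivization.exists_smul_eq_mk_rep ℂ ![t, 1, t ^ 3]
    fun h => one_ne_zero (congrFun h 1)
  refine ⟨a, a.ne_zero, ha.symm.trans ?_⟩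
  ext i
  fin_cases i <;> simp [Units.smul_def]

theorem isHomogeneous_cuspForm : cuspForm.IsHomogeneous 3 :=
  (isHomogeneous_X_pow 0 3).sub ((isHomogeneous_X_pow 1 2).mul (isHomogeneous_X ℂ 2))

theorem not_hasMultGE_two_cuspForm (t : ℂ) : ¬ HasMultGE cuspForm (cuspPoint t) 2 := by
  obtain ⟨a, ha, hrep⟩ := exists_cuspPoint_rep t
  intro h
  -- The line through the point in the direction `(0, 0, 1)` meets the curve transversally.
  have := pow_dvd_aeval_mul h (Polynomial.X : Polynomial ℂ) ![0, 0, 1]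
  rw [aeval_taylorAt, hrep, Polynomial.X_pow_dvd_iff] at this
  have hcoeff := this 1 one_lt_two
  have heq : aeval (fun i => Polynomial.X * (![0, 0, 1] : Fin 3 → Polynomial ℂ) i +
      algebraMap ℂ (Polynomial ℂ) (![a * t, a, a * t ^ 3] i)) cuspForm =
      -(Polynomial.C (a ^ 2) * Polynomial.X) := by
    simp [cuspForm]
    ring
  rw [heq, Polynomial.coeff_neg, Polynomial.coeff_C_mul, Polynomial.coeff_X_one] at hcoeff
  simp [ha] at hcoeff

theorem X_sub_C_pow_dvd_cuspRestrict {F : MvPolynomial (Fin 3) ℂ} {d m : ℕ} {t : ℂ}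
    (hF : F.IsHomogeneous d) (h : HasMultGE F (cuspPoint t) m) :
    (Polynomial.X - Polynomial.C t) ^ m ∣ cuspRestrict F := by
  obtain ⟨a, ha, hrep⟩ := exists_cuspPoint_rep t
  have key := pow_dvd_aeval_mul h (Polynomial.X - Polynomial.C t)
    fun i => Polynomial.C a *
      ![1, 0, Polynomial.X ^ 2 + Polynomial.C t * Polynomial.X + Polynomial.C t ^ 2] i
  rw [aeval_taylorAt, hrep] at key
  have hparam : (fun i => (Polynomial.X - Polynomial.C t) * (Polynomial.C a *
      (![1, 0, Polynomial.X ^ 2 + Polynomial.C t * Polynomial.X + Polynomial.C t ^ 2] :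
        Fin 3 → Polynomial ℂ) i) + algebraMap ℂ (Polynomial ℂ) (![a * t, a, a * t ^ 3] i)) =
      fun i => Polynomial.C a * ![Polynomial.X, 1, Polynomial.X ^ 3] i := by
    funext i
    fin_cases i <;> simp <;> ring
  rw [hparam, aeval_const_mul_of_isHomogeneous hF] at key
  have hu : IsUnit (Polynomial.C a ^ d) := (Polynomial.isUnit_C.2 ha.isUnit).pow d
  exact hu.dvd_mul_left.1 key

theorem cuspRestrict_monomial (e : Fin 3 →₀ ℕ) (c : ℂ) :
    cuspRestrict (monomial e c) = Polynomial.monomial (e 0 + 3 * e 2) c := by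
  rw [cuspRestrict, aeval_monomial, Finsupp.prod_fintype _ _ (by simp), Fin.prod_univ_three,
    ← Polynomial.C_mul_X_pow_eq_monomial]
  simp [pow_add, pow_mul]

theorem coeff_cuspRestrict_eq_zero {F : MvPolynomial (Fin 3) ℂ} {d n : ℕ} (hF : F.IsHomogeneous d)
    (hn : ∀ e : Fin 3 →₀ ℕ, e 0 + e 1 + e 2 = d → e 0 + 3 * e 2 ≠ n) :
    (cuspRestrict F).coeff n = 0 := by
  rw [F.as_sum, map_sum, Polynomial.finsetSum_coeff]
  refine Finset.sum_eq_zero fun e he => ?_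
  rw [cuspRestrict_monomial, Polynomial.coeff_monomial, if_neg]
  refine hn e ?_
  rw [← Fin.sum_univ_three, ← Finsupp.degree_eq_sum]
  by_contra h
  exact (mem_support_iff.1 he) (hF.coeff_eq_zero h)

theorem natDegree_cuspRestrict_le {F : MvPolynomial (Fin 3) ℂ} {d : ℕ} (hF : F.IsHomogeneous d) :
    (cuspRestrict F).natDegree ≤ 3 * d :=
  Polynomial.natDegree_le_iff_coeff_eq_zero.2 fun n hn =>
    coeff_cuspRestrict_eq_zero hF fun e he => by omega

/-- The monomial `xᵃyᵇzᶜ` of degree `d` restricts to `t ^ (3d - 2a - 3b)`, and `2a + 3b` is never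
`1`. This gap is the trace of the cusp, and it forces the parameters of the intersection points
with a curve to add up to zero. -/
theorem coeff_cuspRestrict_subleading {F : MvPolynomial (Fin 3) ℂ} {d n : ℕ}
    (hF : F.IsHomogeneous d) (hn : n + 1 = 3 * d) : (cuspRestrict F).coeff n = 0 :=
  coeff_cuspRestrict_eq_zero hF fun e he => by omega

/-- A form that vanishes on the cuspidal cubic is divisible by its equation: modulo `x³ - y²z`,
a monomial of degree `d` depends only on its restriction to the curve. -/
theorem cuspForm_dvd_of_cuspRestrict_eq_zero {F : MvPolynomial (Fin 3) ℂ} {d : ℕ}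
    (hF : F.IsHomogeneous d) (h : cuspRestrict F = 0) : cuspForm ∣ F := by
  let Φ : Polynomial ℂ →ₗ[ℂ] MvPolynomial (Fin 3) ℂ := Polynomial.lsum fun n =>
    LinearMap.toSpanSingleton ℂ _
      (X 0 ^ (n % 3) * X 1 ^ (d - n % 3 - n / 3) * X 2 ^ (n / 3) : MvPolynomial (Fin 3) ℂ)
  suffices H : cuspForm ∣ F - Φ (cuspRestrict F) by simpa [h] using H
  have hmon : ∀ e ∈ F.support,
      cuspForm ∣ monomial e (coeff e F) - Φ (cuspRestrict (monomial e (coeff e F))) := by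
    intro e he
    have hd : e 0 + e 1 + e 2 = d := by
      rw [← Fin.sum_univ_three, ← Finsupp.degree_eq_sum]
      by_contra h
      exact (mem_support_iff.1 he) (hF.coeff_eq_zero h)
    have h1 : (e 0 + 3 * e 2) % 3 = e 0 % 3 := by omega
    have h2 : (e 0 + 3 * e 2) / 3 = e 2 + e 0 / 3 := by omega
    have h3 : d - e 0 % 3 - (e 2 + e 0 / 3) = e 1 + 2 * (e 0 / 3) := by omega
    have h0 : X 0 ^ e 0 = (X 0 ^ (e 0 % 3) * (X 0 ^ 3) ^ (e 0 / 3) : MvPolynomial (Fin 3) ℂ) := by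
      rw [← pow_mul, ← pow_add, Nat.mod_add_div]
    have hΦ : Φ (cuspRestrict (monomial e (coeff e F))) = C (coeff e F) *
        (X 0 ^ (e 0 % 3) * X 1 ^ (e 1 + 2 * (e 0 / 3)) * X 2 ^ (e 2 + e 0 / 3)) := by
      rw [cuspRestrict_monomial]
      simp only [Φ, Polynomial.lsum_apply]
      rw [Polynomial.sum_monomial_index _ _ (by simp), h1, h2, h3,
        LinearMap.toSpanSingleton_apply, smul_eq_C_mul]
    have hm : monomial e (coeff e F) = C (coeff e F) * (X 0 ^ e 0 * X 1 ^ e 1 * X 2 ^ e 2) := by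
      rw [monomial_eq, Finsupp.prod_fintype _ _ (by simp), Fin.prod_univ_three]
    rw [hΦ, hm, h0]
    have hdvd : cuspForm ∣ (X 0 ^ 3) ^ (e 0 / 3) - (X 1 ^ 2 * X 2) ^ (e 0 / 3) :=
      sub_dvd_pow_sub_pow _ _ _
    convert hdvd.mul_left (C (coeff e F) * (X 0 ^ (e 0 % 3) * X 1 ^ e 1 * X 2 ^ e 2)) using 1
    ring
  have hsum := Finset.dvd_sum hmon
  rwa [Finset.sum_sub_distrib, ← map_sum, ← map_sum, ← F.as_sum] at hsum

/-- No form cuts out on the cuspidal cubic exactly `m` times the sum of nine points whose parameters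
do not add up to zero: the smooth points form the group `ℂ`, which is torsion-free. So a form of
degree `3m` with multiplicity `m` at the nine points vanishes on the cubic. -/
theorem cuspRestrict_eq_zero {ι : Type*} [Fintype ι] (hι : Fintype.card ι = 9) {t : ι → ℂ}
    (ht : Function.Injective t) (hsum : ∑ i, t i ≠ 0) {m : ℕ} (hm : 0 < m)
    {F : MvPolynomial (Fin 3) ℂ} (hF : F.IsHomogeneous (3 * m))
    (h : ∀ i, HasMultGE F (cuspPoint (t i)) m) : cuspRestrict F = 0 := by
  set P : Polynomial ℂ := ∏ i, (Polynomial.X - Polynomial.C (t i)) with hP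
  have hPm : P.Monic := Polynomial.monic_prod_X_sub_C _ _
  have hPdeg : (P ^ m).natDegree = 9 * m := by
    rw [hPm.natDegree_pow, hP, Polynomial.natDegree_finsetProd_X_sub_C_eq_card, Finset.card_univ,
      hι, mul_comm]
  have hdvd : P ^ m ∣ cuspRestrict F := by
    rw [hP, ← Finset.prod_pow]
    refine Finset.prod_dvd_of_coprime (fun i _ j _ hij => ?_)
      fun i _ => X_sub_C_pow_dvd_cuspRestrict hF (h i)
    exact (Polynomial.pairwise_coprime_X_sub_C ht hij).pow
  obtain ⟨q, hq⟩ := hdvd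
  by_contra hne
  -- By degrees, the restriction is a constant multiple of `P ^ m`. Its coefficient of degree
  -- `9m - 1` is zero, but that of `P ^ m` is `-m ∑ tᵢ`.
  have hq0 : q ≠ 0 := by rintro rfl; exact hne (by rw [hq, mul_zero])
  have hle := natDegree_cuspRestrict_le hF
  rw [hq, (hPm.pow m).natDegree_mul' hq0, hPdeg] at hle
  obtain ⟨c, rfl⟩ := Polynomial.natDegree_eq_zero.1 (show q.natDegree = 0 by omega)
  have hsub := coeff_cuspRestrict_subleading hF (n := 9 * m - 1) (by omega)
  have hnext : (P ^ m).coeff (9 * m - 1) = m • (-∑ i, t i) := by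
    rw [← hPdeg, ← Polynomial.nextCoeff_of_natDegree_pos (by omega), hPm.nextCoeff_pow, hP,
      Polynomial.prod_X_sub_C_nextCoeff]
  rw [hq, Polynomial.coeff_mul_C, hnext] at hsub
  simp [hm.ne', hsum] at hsub
  exact hq0 (by rw [hsub, map_zero])

/-- Through nine points on the cuspidal cubic whose parameters do not add up to zero, the only
curve of degree `3m` with multiplicity `m` is the `m`-fold cubic. -/
theorem exists_eq_C_mul_cuspForm_pow {ι : Type*} [Fintype ι] (hι : Fintype.card ι = 9) {t : ι → ℂ}
    (ht : Function.Injective t) (hsum : ∑ i, t i ≠ 0) {m : ℕ} {F : MvPolynomial (Fin 3) ℂ}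
    (hF : F.IsHomogeneous (3 * m)) (h : ∀ i, HasMultGE F (cuspPoint (t i)) m) :
    ∃ c : ℂ, F = C c * cuspForm ^ m := by
  induction m generalizing F with
  | zero =>
    refine ⟨coeff 0 F, ?_⟩
    rw [pow_zero, mul_one]
    exact totalDegree_eq_zero_iff_eq_C.1 ((totalDegree_zero_iff_isHomogeneous (p := F)).2 hF)
  | succ m ih =>
    have hdvd := cuspForm_dvd_of_cuspRestrict_eq_zero hF
      (cuspRestrict_eq_zero hι ht hsum m.succ_pos hF h)
    obtain ⟨Q, hQ, rfl⟩ := exists_isHomogeneous_eq_mul_of_dvd (a := 3) (b := 3 * m)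
      (by rwa [show 3 + 3 * m = 3 * (m + 1) by ring]) isHomogeneous_cuspForm hdvd
    obtain ⟨c, rfl⟩ := ih hQ fun i => (h i).of_mul_left (not_hasMultGE_two_cuspForm _)
    exact ⟨c, by ring⟩

/-! ### The vanishing of a linear system is an open condition -/

/-- The Taylor expansion `F(V + X)` at an indeterminate vector `V`, whose coordinates are the
variables of the coefficient ring. -/
noncomputable def universalTaylor :
    MvPolynomial (Fin 3) ℂ →ₐ[ℂ] MvPolynomial (Fin 3) (MvPolynomial (Fin 3) ℂ) :=
  aeval (fun i => X i + C (X i))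

theorem map_eval_universalTaylor (v : Fin 3 → ℂ) (F : MvPolynomial (Fin 3) ℂ) :
    map (eval v) (universalTaylor F) = taylorAt v F := by
  have : (map (eval v)).comp universalTaylor.toRingHom = (taylorAt v).toRingHom := by
    ext i <;> simp [universalTaylor, taylorAt, MvPolynomial.algebraMap_eq,
      MvPolynomial.algebraMap_apply]
  exact DFunLike.congr_fun this F

/-- Every nonzero coefficient of `Q`, say at `e`, is a form of degree `D - |e|`: the polynomial is
homogeneous of degree `D` in the two groups of variables together. -/
def IsJointlyHomogeneous (Q : MvPolynomial (Fin 3) (MvPolynomial (Fin 3) ℂ)) (D : ℕ) : Prop :=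
  ∀ e : Fin 3 →₀ ℕ, coeff e Q = 0 ∨ ∃ n, n + e.degree = D ∧ (coeff e Q).IsHomogeneous n

theorem IsJointlyHomogeneous.isHomogeneous_coeff
    {Q : MvPolynomial (Fin 3) (MvPolynomial (Fin 3) ℂ)} {D : ℕ} (h : IsJointlyHomogeneous Q D)
    (e : Fin 3 →₀ ℕ) : (coeff e Q).IsHomogeneous (D - e.degree) := by
  obtain h0 | ⟨n, hn, hh⟩ := h e
  · rw [h0]; exact isHomogeneous_zero _ _ _
  · rwa [← hn, Nat.add_sub_cancel]

theorem IsJointlyHomogeneous.mul {Q R : MvPolynomial (Fin 3) (MvPolynomial (Fin 3) ℂ)} {D E : ℕ}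
    (hQ : IsJointlyHomogeneous Q D) (hR : IsJointlyHomogeneous R E) :
    IsJointlyHomogeneous (Q * R) (D + E) := by
  intro e
  rw [or_iff_not_imp_left]
  intro hne
  rw [coeff_mul] at hne ⊢
  have hterm : ∀ x ∈ Finset.HasAntidiagonal.antidiagonal e, coeff x.1 Q * coeff x.2 R = 0 ∨
      ∃ n, n + e.degree = D + E ∧ (coeff x.1 Q * coeff x.2 R).IsHomogeneous n := by
    intro x hx
    rw [Finset.HasAntidiagonal.mem_antidiagonal] at hx
    obtain h | ⟨n, hn, hn'⟩ := hQ x.1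
    · simp [h]
    obtain h | ⟨k, hk, hk'⟩ := hR x.2
    · simp [h]
    refine Or.inr ⟨n + k, ?_, hn'.mul hk'⟩
    rw [← hx, map_add]
    omega
  obtain ⟨x, hx, hx0⟩ := Finset.exists_ne_zero_of_sum_ne_zero hne
  obtain ⟨n, hn, -⟩ := (hterm x hx).resolve_left hx0
  refine ⟨n, hn, IsHomogeneous.sum _ _ _ fun y hy => ?_⟩
  obtain h | ⟨k, hk, hk'⟩ := hterm y hy
  · rw [h]; exact isHomogeneous_zero _ _ _
  · rwa [show n = k by omega]

theorem isJointlyHomogeneous_one : IsJointlyHomogeneous 1 0 := by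
  intro e
  rw [coeff_one]
  split_ifs with h
  · exact Or.inr ⟨0, by simp [← h], isHomogeneous_one _ _⟩
  · exact Or.inl rfl

theorem IsJointlyHomogeneous.pow {Q : MvPolynomial (Fin 3) (MvPolynomial (Fin 3) ℂ)} {D : ℕ}
    (hQ : IsJointlyHomogeneous Q D) (n : ℕ) : IsJointlyHomogeneous (Q ^ n) (D * n) := by
  induction n with
  | zero => simpa using isJointlyHomogeneous_one
  | succ n ih => rw [pow_succ, mul_add, mul_one]; exact ih.mul hQ

theorem isJointlyHomogeneous_X_add_C (i : Fin 3) :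
    IsJointlyHomogeneous (X i + C (X i)) 1 := by
  intro e
  rw [coeff_add, coeff_C, coeff_X]
  by_cases h1 : Finsupp.single i 1 = e
  · have h0 : (0 : Fin 3 →₀ ℕ) ≠ e := by
      rintro rfl; simp at h1
    rw [if_pos h1, if_neg h0, add_zero]
    exact Or.inr ⟨0, by simp [← h1], isHomogeneous_one _ _⟩
  · rw [if_neg h1, zero_add]
    split_ifs with h0
    · exact Or.inr ⟨1, by simp [← h0], isHomogeneous_X _ _⟩
    · exact Or.inl rfl

theorem isJointlyHomogeneous_universalTaylor_monomial (a : Fin 3 →₀ ℕ) :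
    IsJointlyHomogeneous (universalTaylor (monomial a 1)) a.degree := by
  rw [universalTaylor, aeval_monomial, Finsupp.prod_fintype _ _ (by simp), map_one, one_mul,
    Finsupp.degree_eq_sum, Fin.prod_univ_three, Fin.sum_univ_three]
  have h (i : Fin 3) := (isJointlyHomogeneous_X_add_C i).pow (a i)
  simp only [one_mul] at h
  exact ((h 0).mul (h 1)).mul (h 2)

/-- A family of vectors that no nonzero vector annihilates contains a square submatrix of nonzero
determinant. -/
theorem exists_det_ne_zero {K ι κ : Type*} [Field K] [Fintype κ] [DecidableEq κ]
    (M : ι → κ → K) (hM : ∀ x : κ → K, (∀ i, M i ⬝ᵥ x = 0) → x = 0) :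
    ∃ r : κ → ι, (Matrix.of fun a b => M (r a) b).det ≠ 0 := by
  have hspan : Submodule.span K (Set.range M) = ⊤ := by
    by_contra hne
    obtain ⟨f, hf0, hf⟩ := Submodule.exists_le_ker_of_lt_top _ (lt_top_iff_ne_top.2 hne)
    have hfx (y : κ → K) : y ⬝ᵥ (fun a => f (Pi.single a 1)) = f y := by
      conv_rhs => rw [pi_eq_sum_univ' y, map_sum]
      simp [dotProduct]
    have hx := hM (fun a => f (Pi.single a 1)) fun i => by
      rw [hfx]; exact hf (Submodule.subset_span ⟨i, rfl⟩)
    apply hf0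
    ext a
    simpa using congrFun hx a
  obtain ⟨s, r, hr, hsp, hli⟩ := exists_linearIndependent' K M
  rw [hspan] at hsp
  let B := Module.Basis.mk hli hsp.ge
  have e : κ ≃ s := (Pi.basisFun K κ).indexEquiv B
  refine ⟨r ∘ e, fun hdet => ?_⟩
  have hu := (Matrix.linearIndependent_rows_iff_isUnit
    (A := Matrix.of fun a b => M ((r ∘ e) a) b)).1 (hli.comp e e.injective)
  exact ((Matrix.isUnit_iff_isUnit_det _).1 hu).ne_zero hdet

theorem IsMultihomogeneous.mul {k : ℕ} {G H : MvPolynomial (Fin k × Fin 3) ℂ}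
    (hG : IsMultihomogeneous G) (hH : IsMultihomogeneous H) : IsMultihomogeneous (G * H) := by
  intro i
  obtain ⟨a, ha⟩ := hG i
  obtain ⟨b, hb⟩ := hH i
  exact ⟨a + b, ha.mul hb⟩

theorem IsMultihomogeneous.prod {k : ℕ} {ι : Type*} (s : Finset ι)
    {G : ι → MvPolynomial (Fin k × Fin 3) ℂ} (hG : ∀ j, IsMultihomogeneous (G j)) :
    IsMultihomogeneous (∏ j ∈ s, G j) := by
  intro i
  choose a ha using fun j => hG j i
  exact ⟨_, IsWeightedHomogeneous.prod s G a fun j _ => ha j⟩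

theorem isMultihomogeneous_X {k : ℕ} (q : Fin k × Fin 3) :
    IsMultihomogeneous (X q : MvPolynomial (Fin k × Fin 3) ℂ) :=
  fun _ => ⟨_, isWeightedHomogeneous_X _ _ _⟩

theorem isWeightedHomogeneous_rename {k n : ℕ} {P : MvPolynomial (Fin 3) ℂ}
    (hP : P.IsHomogeneous n) (i j : Fin k) :
    (rename (fun l => (j, l)) P).IsWeightedHomogeneous
      (fun q : Fin k × Fin 3 => if q.1 = i then (1 : ℕ) else 0) (if j = i then n else 0) := by
  intro e he
  obtain ⟨u, rfl, hu⟩ := coeff_rename_ne_zero _ _ _ he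
  have hd : u.degree = n := by
    by_contra h
    exact hu (hP.coeff_eq_zero h)
  rw [Finsupp.weight_apply, Finsupp.sum_mapDomain_index (by simp) (by intros; exact add_smul _ _ _)]
  split_ifs with h <;> simp [Finsupp.sum_fintype, ← hd, Finsupp.degree_eq_sum]

/-- A matrix whose rows consist of forms of the same degree in a single group of variables has a
multihomogeneous determinant. -/
theorem isMultihomogeneous_det {k : ℕ} {κ : Type*} [Fintype κ] [DecidableEq κ]
    (P : κ → κ → MvPolynomial (Fin 3) ℂ) (g : κ → Fin k) (n : κ → ℕ)
    (hP : ∀ a b, (P a b).IsHomogeneous (n a)) :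
    IsMultihomogeneous (Matrix.of fun a b => rename (fun l => (g a, l)) (P a b)).det := by
  intro i
  refine ⟨∑ a, if g a = i then n a else 0, ?_⟩
  rw [Matrix.det_apply']
  refine IsWeightedHomogeneous.sum _ _ _ fun σ _ => ?_
  rw [← zero_add (∑ a, _), ← Equiv.sum_comp σ]
  refine IsWeightedHomogeneous.mul ?_ ?_
  · rw [show ((Equiv.Perm.sign σ : ℤ) : MvPolynomial (Fin k × Fin 3) ℂ) =
      C ((Equiv.Perm.sign σ : ℤ) : ℂ) by simp]
    exact isWeightedHomogeneous_C _ _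
  · exact IsWeightedHomogeneous.prod _ _ _ fun a _ => isWeightedHomogeneous_rename (hP _ _) _ _

/-- If a linear system vanishes at one configuration of points, then it vanishes wherever a
suitable multihomogeneous polynomial does not: a maximal minor of the matrix of the linear
conditions that the multiplicities impose on the coefficients of a form. -/
theorem exists_isMultihomogeneous_of_forms_eq_bot {k d : ℕ} {μ : Fin k → ℕ} {p₀ : Fin k → Plane}
    (h : forms d μ p₀ = ⊥) :
    ∃ G : MvPolynomial (Fin k × Fin 3) ℂ, IsMultihomogeneous G ∧
      eval (fun q => (p₀ q.1).rep q.2) G ≠ 0 ∧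
      ∀ p : Fin k → Plane, eval (fun q => (p q.1).rep q.2) G ≠ 0 → forms d μ p = ⊥ := by
  classical
  let κ := {a : Fin 3 →₀ ℕ // a ∈ Finset.finsuppAntidiag Finset.univ d}
  let _ : Fintype κ := Finset.Subtype.fintype _
  have hκ (a : Fin 3 →₀ ℕ) : a ∈ Finset.finsuppAntidiag Finset.univ d ↔ a.degree = d := by
    simp [Finset.mem_finsuppAntidiag, Finsupp.degree_eq_sum]
  let ι := Σ i : Fin k, {e : Fin 3 →₀ ℕ // e.degree < μ i}
  let P (e : Fin 3 →₀ ℕ) (a : κ) : MvPolynomial (Fin 3) ℂ :=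
    coeff e (universalTaylor (monomial a.1 1))
  let M (p : Fin k → Plane) (r : ι) (a : κ) : ℂ := eval (p r.1).rep (P r.2 a)
  have hM (p : Fin k → Plane) (x : κ → ℂ) (r : ι) :
      M p r ⬝ᵥ x = coeff r.2.1 (taylorAt (p r.1).rep (∑ a : κ, monomial a.1 (x a))) := by
    rw [map_sum, coeff_sum, dotProduct]
    refine Finset.sum_congr rfl fun a _ => ?_
    rw [show monomial a.1 (x a) = x a • monomial a.1 (1 : ℂ) by simp [smul_monomial], map_smul,
      coeff_smul, ← map_eval_universalTaylor, coeff_map, smul_eq_mul, mul_comm]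
  have hcoeff (x : κ → ℂ) (a : κ) : coeff a.1 (∑ b : κ, monomial b.1 (x b)) = x a := by
    rw [coeff_sum, Finset.sum_eq_single a, coeff_monomial, if_pos rfl]
    · intro b _ hb
      rw [coeff_monomial, if_neg fun h => hb (Subtype.ext h)]
    · simp
  have hdegree (a : κ) : a.1.degree = d := (hκ a.1).1 a.2
  obtain ⟨r, hr⟩ := exists_det_ne_zero (M p₀) fun x hx => by
    have hmem : ∑ a : κ, monomial a.1 (x a) ∈ forms d μ p₀ := by
      refine ⟨IsHomogeneous.sum _ _ _ fun a _ => isHomogeneous_monomial _ (hdegree a), ?_⟩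
      intro i e he
      rw [← hM p₀ x ⟨i, e, he⟩, hx]
    rw [h, Submodule.mem_bot] at hmem
    funext a
    rw [← hcoeff x a, hmem, coeff_zero, Pi.zero_apply]
  have heval (p : Fin k → Plane) : eval (fun q => (p q.1).rep q.2)
      (Matrix.of fun a b => rename (fun l => ((r a).1, l)) (P (r a).2 b)).det =
      (Matrix.of fun a b => M p (r a) b).det := by
    rw [RingHom.map_det]
    congr 1
    ext a b
    simp [M, eval_rename, Function.comp_def]
  refine ⟨(Matrix.of fun a b => rename (fun l => ((r a).1, l)) (P (r a).2 b)).det,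
    isMultihomogeneous_det (fun a b => P (r a).2 b) _ (fun a => d - (r a).2.1.degree) ?_, ?_, ?_⟩
  · intro a b
    have := (isJointlyHomogeneous_universalTaylor_monomial b.1).isHomogeneous_coeff (r a).2.1
    rwa [hdegree] at this
  · rwa [heval]
  · intro p hp
    rw [heval] at hp
    rw [eq_bot_iff]
    intro F hF
    have hsum : F = ∑ a : κ, monomial a.1 (coeff a.1 F) := by
      ext e
      by_cases he : e.degree = d
      · exact (hcoeff (fun a => coeff a.1 F) ⟨e, (hκ e).2 he⟩).symm
      · rw [hF.1.coeff_eq_zero he]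
        exact ((IsHomogeneous.sum _ _ d fun a _ =>
          isHomogeneous_monomial _ (hdegree a)).coeff_eq_zero he).symm
    have hzero : (fun a : κ => coeff a.1 F) = 0 := by
      refine Matrix.eq_zero_of_mulVec_eq_zero hp ?_
      funext a
      have := hM p (fun a : κ => coeff a.1 F) (r a)
      rw [← hsum, hF.2 _ _ (r a).2.2] at this
      exact this
    rw [Submodule.mem_bot, hsum]
    exact Finset.sum_eq_zero fun a _ => by
      rw [show coeff a.1 F = 0 from congrFun hzero a, map_zero]

theorem eval_mul_of_isMultihomogeneous {k : ℕ} {G : MvPolynomial (Fin k × Fin 3) ℂ}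
    (hG : IsMultihomogeneous G) (c : Fin k → ℂ) :
    ∃ a : Fin k → ℕ, ∀ v : Fin k × Fin 3 → ℂ,
      eval (fun q => c q.1 * v q) G = (∏ i, c i ^ a i) * eval v G := by
  choose a ha using hG
  refine ⟨a, fun v => ?_⟩
  rw [eval_eq', eval_eq', Finset.mul_sum]
  refine Finset.sum_congr rfl fun e he => ?_
  have hc : ∏ q, c q.1 ^ e q = ∏ i, c i ^ a i := by
    rw [Fintype.prod_prod_type]
    refine Finset.prod_congr rfl fun i _ => ?_
    simp only [Finset.prod_pow_eq_pow_sum]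
    have := ha i (mem_support_iff.1 he)
    rw [Finsupp.weight_apply, Finsupp.sum_fintype _ _ (by simp), Fintype.sum_prod_type] at this
    rw [← this]
    simp
  simp_rw [mul_pow]
  rw [Finset.prod_mul_distrib, hc]
  ring

/-- A nonzero multihomogeneous polynomial does not vanish at some configuration of points. -/
theorem exists_eval_rep_ne_zero {k : ℕ} {G : MvPolynomial (Fin k × Fin 3) ℂ}
    (hG : IsMultihomogeneous G) (h0 : G ≠ 0) :
    ∃ p : Fin k → Plane, eval (fun q => (p q.1).rep q.2) G ≠ 0 := by
  -- The factor `∏ i, X (i, 0)` excludes the vectors that are zero in some group of variables.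
  have hne : G * ∏ i : Fin k, X (i, 0) ≠ 0 :=
    mul_ne_zero h0 (Finset.prod_ne_zero_iff.2 fun i _ => X_ne_zero _)
  obtain ⟨v, hv⟩ : ∃ v, eval v (G * ∏ i : Fin k, X (i, 0)) ≠ 0 := by
    by_contra! h
    exact hne (MvPolynomial.funext fun v => by rw [h v, map_zero])
  rw [map_mul, map_prod] at hv
  have hvi (i : Fin k) : (fun l => v (i, l)) ≠ 0 := fun h => by
    have := Finset.prod_ne_zero_iff.1 (right_ne_zero_of_mul hv) i (Finset.mem_univ i)
    rw [eval_X] at this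
    exact this (congrFun h 0)
  choose c hc using fun i => Projectivization.exists_smul_eq_mk_rep ℂ _ (hvi i)
  refine ⟨fun i => Projectivization.mk ℂ _ (hvi i), ?_⟩
  obtain ⟨a, ha⟩ := eval_mul_of_isMultihomogeneous hG fun i => (c i : ℂ)
  have : (fun q : Fin k × Fin 3 => (Projectivization.mk ℂ _ (hvi q.1)).rep q.2) =
      fun q => (c q.1 : ℂ) * v q := by
    funext q
    rw [← hc q.1]
    rfl
  rw [this, ha]
  exact mul_ne_zero (Finset.prod_ne_zero_iff.2 fun i _ => pow_ne_zero _ (c i).ne_zero)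
    (left_ne_zero_of_mul hv)

/-- Finitely many linear systems, each of which vanishes at some configuration of points, vanish
simultaneously at general points, since `(ℙ²)ᵏ` is irreducible. -/
theorem forGeneralPoints_forms_eq_bot {k : ℕ} {ι : Type*} [Fintype ι] (d : ι → ℕ)
    (μ : ι → Fin k → ℕ) (h : ∀ j, ∃ p, forms (d j) (μ j) p = ⊥) :
    ForGeneralPoints k fun p => ∀ j, forms (d j) (μ j) p = ⊥ := by
  choose p₀ hp₀ using h
  choose G hG hG0 hGp using fun j => exists_isMultihomogeneous_of_forms_eq_bot (hp₀ j)
  have hprod : IsMultihomogeneous (∏ j, G j) := IsMultihomogeneous.prod _ hG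
  refine ⟨{p | eval (fun q => (p q.1).rep q.2) (∏ j, G j) ≠ 0}, ⟨{∏ j, G j}, ?_, ?_⟩, ?_, ?_⟩
  · rintro _ rfl; exact hprod
  · ext p; simp
  · refine exists_eval_rep_ne_zero hprod (Finset.prod_ne_zero_iff.2 fun j _ h => hG0 j ?_)
    rw [h, map_zero]
  · intro p hp j
    rw [Set.mem_ofPred_eq, map_prod] at hp
    exact hGp j p (Finset.prod_ne_zero_iff.1 hp j (Finset.mem_univ j))

/-! ### Ten general points -/

theorem mem_forms_insertNth {k : ℕ} {d m n : ℕ} {p : Fin (k + 1) → Plane} {j : Fin (k + 1)}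
    {F : MvPolynomial (Fin 3) ℂ} :
    F ∈ forms d (j.insertNth (α := fun _ => ℕ) n fun _ => m) p ↔
      F ∈ forms d (fun _ => m) (p ∘ j.succAbove) ∧ HasMultGE F (p j) n := by
  change (F.IsHomogeneous d ∧ ∀ i, _) ↔ (F.IsHomogeneous d ∧ ∀ i, _) ∧ _
  rw [Fin.forall_iff_succAbove j]
  simp only [Fin.insertNth_apply_same, Fin.insertNth_apply_succAbove, Function.comp_apply]
  tauto

/-- On a suitable configuration of ten points, nine of them on a cuspidal cubic and the tenth, with
index `j`, not on it, there is no curve of degree `3m` with multiplicity `m` at the nine points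
and passing through the tenth. -/
theorem exists_forms_insertNth_eq_bot (m : ℕ) (j : Fin 10) :
    ∃ p : Fin 10 → Plane, forms (3 * m) (j.insertNth (α := fun _ => ℕ) 1 fun _ => m) p = ⊥ := by
  have hv : (![1, 0, 0] : Fin 3 → ℂ) ≠ 0 := fun h => one_ne_zero (congrFun h 0)
  let t : Fin 9 → ℂ := fun i => ((i : ℕ) : ℂ) + 1
  have ht : Function.Injective t := fun a b h => by
    simpa [t, Fin.ext_iff] using h
  have hsum : ∑ i, t i ≠ 0 := by
    simp only [t, Fin.sum_univ_succ]
    norm_num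
  refine ⟨j.insertNth (α := fun _ => Plane) (Projectivization.mk ℂ ![1, 0, 0] hv)
    fun i => cuspPoint (t i), ?_⟩
  rw [eq_bot_iff]
  intro F hF
  rw [mem_forms_insertNth, Fin.insertNth_apply_same] at hF
  obtain ⟨⟨hhom, hmult⟩, hval⟩ := hF
  obtain ⟨c, rfl⟩ := exists_eq_C_mul_cuspForm_pow (Fintype.card_fin 9) ht hsum hhom fun i => by
    have := hmult i
    rwa [Function.comp_apply, Fin.insertNth_apply_succAbove] at this
  obtain ⟨a, ha⟩ := Projectivization.exists_smul_eq_mk_rep ℂ _ hv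
  rw [hasMultGE_one_iff, ← ha] at hval
  have hc : c = 0 := by simpa [cuspForm, Units.smul_def] using hval
  simp [hc]

theorem exists_linearForm_vanishing_at (p : Plane) :
    ∃ L : MvPolynomial (Fin 3) ℂ, L ≠ 0 ∧ L.IsHomogeneous 1 ∧ HasMultGE L p 1 := by
  simp_rw [hasMultGE_one_iff]
  by_cases h : p.rep 0 = 0
  · exact ⟨X 0, X_ne_zero 0, isHomogeneous_X _ _, by simpa using h⟩
  · refine ⟨C (p.rep 1) * X 0 - C (p.rep 0) * X 1, fun h0 => h ?_,
      (isHomogeneous_C_mul_X _ _).sub (isHomogeneous_C_mul_X _ _), by simp [mul_comm]⟩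
    have := congrArg (eval ![0, -1, 0]) h0
    simpa using this

/-- Vanishing at nine points imposes at most nine conditions on the ten coefficients of a cubic. -/
theorem exists_cubic_ne_zero (p : Fin 9 → Plane) : ∃ F ∈ forms 3 (fun _ => 1) p, F ≠ 0 := by
  let κ := {a : Fin 3 →₀ ℕ // a ∈ Finset.finsuppAntidiag Finset.univ 3}
  let _ : Fintype κ := Finset.Subtype.fintype _
  have hcard : Fintype.card κ = 10 := by
    rw [Fintype.card_coe, Finset.card_finsuppAntidiag_nat_eq_choose]
    simp [Nat.choose]
  let f : (κ → ℂ) →ₗ[ℂ] MvPolynomial (Fin 3) ℂ :=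
    ∑ a : κ, (monomial a.1).comp (LinearMap.proj a)
  let φ : (κ → ℂ) →ₗ[ℂ] Fin 9 → ℂ :=
    (LinearMap.pi fun i => (aeval (p i).rep).toLinearMap).comp f
  have hker : LinearMap.ker φ ≠ ⊥ := LinearMap.ker_ne_bot_of_finrank_lt (by simp [hcard])
  obtain ⟨x, hx, hx0⟩ := Submodule.exists_mem_ne_zero_of_ne_bot hker
  have hf : f x = ∑ a : κ, monomial a.1 (x a) := by simp [f]
  refine ⟨f x, ⟨?_, fun i => hasMultGE_one_iff.2 (congrFun hx i)⟩, fun h => hx0 ?_⟩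
  · rw [hf]
    refine IsHomogeneous.sum _ _ _ fun a _ => isHomogeneous_monomial _ ?_
    rw [Finsupp.degree_eq_sum]
    exact (Finset.mem_finsuppAntidiag.1 a.2).1
  · funext a
    have := congrArg (coeff a.1) h
    rw [hf, coeff_sum, Finset.sum_eq_single a, coeff_monomial, if_pos rfl] at this
    · exact this
    · intro b _ hb
      rw [coeff_monomial, if_neg fun h => hb (Subtype.ext h)]
    · simp

theorem isEmpty_linearSystem {k d : ℕ} {m : Fin k → ℕ} {p : Fin k → Plane}
    (h : ∀ F ∈ forms d m p, F = 0) : IsEmpty (LinearSystem d m p) :=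
  ⟨fun x => x.rep_nonzero (Subtype.ext (h _ x.rep.2))⟩

theorem eq_span_singleton_of_eval_injective {W : Submodule ℂ (MvPolynomial (Fin 3) ℂ)}
    {v : Fin 3 → ℂ} (hW : ∀ F ∈ W, eval v F = 0 → F = 0) {E : MvPolynomial (Fin 3) ℂ} (hE : E ∈ W)
    (hv : eval v E ≠ 0) : W = Submodule.span ℂ {E} := by
  refine le_antisymm (fun F hF => ?_) ((Submodule.span_singleton_le_iff_mem _ _).2 hE)
  refine Submodule.mem_span_singleton.2 ⟨eval v F / eval v E, ?_⟩
  refine (sub_eq_zero.1 (hW _ (W.sub_mem hF (W.smul_mem _ hE)) ?_)).symm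
  rw [map_sub, smul_eval, div_mul_cancel₀ _ hv, sub_self]

theorem pow_mem_forms {k d m : ℕ} {p : Fin k → Plane} {F : MvPolynomial (Fin 3) ℂ}
    (hF : F ∈ forms d (fun _ => 1) p) : F ^ m ∈ forms (d * m) (fun _ => m) p :=
  ⟨hF.1.pow m, fun i => by simpa using (hF.2 i).pow m⟩

/-- If no curve of degree `3m` with multiplicity `m` at nine points passes through a tenth point,
then the cubic through the nine points is unique and misses the tenth point, and its multiples are
the only curves of degree `3m` with multiplicity `m`. -/
theorem exists_cubic_of_forms_insertNth_eq_bot {d m : ℕ} (hm : 0 < m) {p : Fin 10 → Plane}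
    {j : Fin 10} (h : forms (3 * m) (j.insertNth (α := fun _ => ℕ) 1 fun _ => m) p = ⊥) :
    ∃ E : MvPolynomial (Fin 3) ℂ, E ≠ 0 ∧
      forms 3 (fun _ => 1) (p ∘ j.succAbove) = Submodule.span ℂ {E} ∧
      ¬ HasMultGE E (p j) 1 ∧
      (d < 3 * m → IsEmpty (LinearSystem d (fun _ => m) (p ∘ j.succAbove))) ∧
      (d = 3 * m → forms d (fun _ => m) (p ∘ j.succAbove) = Submodule.span ℂ {E ^ m}) := by
  have hzero : ∀ F ∈ forms (3 * m) (fun _ => m) (p ∘ j.succAbove), eval (p j).rep F = 0 → F = 0 :=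
    fun F hF hv => (Submodule.mem_bot ℂ).1
      (h ▸ mem_forms_insertNth.2 ⟨hF, hasMultGE_one_iff.2 hv⟩)
  have hzero3 : ∀ F ∈ forms 3 (fun _ => 1) (p ∘ j.succAbove), eval (p j).rep F = 0 → F = 0 :=
    fun F hF hv => pow_eq_zero_iff hm.ne' |>.1
      (hzero _ (pow_mem_forms hF) (by rw [map_pow, hv, zero_pow hm.ne']))
  obtain ⟨E, hE, hE0⟩ := exists_cubic_ne_zero (p ∘ j.succAbove)
  have hv : eval (p j).rep E ≠ 0 := fun h0 => hE0 (hzero3 E hE h0)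
  refine ⟨E, hE0, eq_span_singleton_of_eval_injective hzero3 hE hv,
    fun h1 => hv (hasMultGE_one_iff.1 h1), fun hd => isEmpty_linearSystem fun F hF => ?_, ?_⟩
  · -- Multiplying by a power of a line through the tenth point raises the degree to `3m`.
    obtain ⟨L, hL0, hL, hLp⟩ := exists_linearForm_vanishing_at (p j)
    have hn : 3 * m - d ≠ 0 := by omega
    have hmem : L ^ (3 * m - d) * F ∈ forms (3 * m) (fun _ => m) (p ∘ j.succAbove) := by
      refine ⟨?_, fun i => ?_⟩
      · have := (hL.pow (3 * m - d)).mul hF.1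
        rwa [one_mul, Nat.sub_add_cancel hd.le] at this
      · have h0 : HasMultGE (L ^ (3 * m - d)) ((p ∘ j.succAbove) i) 0 := fun e he => by simp at he
        simpa using h0.mul (hF.2 i)
    have := hzero _ hmem (by
      rw [map_mul, map_pow, hasMultGE_one_iff.1 hLp, zero_pow hn, zero_mul])
    exact (mul_eq_zero.1 this).resolve_left (pow_ne_zero _ hL0)
  · rintro rfl
    refine eq_span_singleton_of_eval_injective hzero (pow_mem_forms hE) ?_
    rw [map_pow]
    exact pow_ne_zero _ hv

end PlaneCurves

theorem mainTheorem9 (d m : ℕ) (hm : 0 < m) (hdm : (d : ℚ) / (m : ℚ) ≤ 3) :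
    PlaneCurves.ForGeneralPoints 10 (fun p =>
      IsEmpty (PlaneCurves.LinearSystem d (fun _ => m) p) ∧
      ∀ j : Fin 10, ∃ C : MvPolynomial (Fin 3) ℂ, C ≠ 0 ∧
        PlaneCurves.forms 3 (fun _ => 1) (p ∘ j.succAbove) = Submodule.span ℂ {C} ∧
        ¬ PlaneCurves.HasMultGE C (p j) 1 ∧
        (d < 3 * m → IsEmpty (PlaneCurves.LinearSystem d (fun _ => m) (p ∘ j.succAbove))) ∧
        (d = 3 * m →
          PlaneCurves.forms d (fun _ => m) (p ∘ j.succAbove) = Submodule.span ℂ {C ^ m})) := by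
  have hd : d ≤ 3 * m := by
    rw [div_le_iff₀ (by exact_mod_cast hm)] at hdm
    exact_mod_cast hdm
  obtain ⟨U, hU, hne, hp⟩ := PlaneCurves.forGeneralPoints_forms_eq_bot (fun _ : Fin 10 => 3 * m)
    (fun j => j.insertNth (α := fun _ => ℕ) 1 fun _ => m)
    (PlaneCurves.exists_forms_insertNth_eq_bot m)
  refine ⟨U, hU, hne, fun p hpU => ?_⟩
  have hbot := hp p hpU
  refine ⟨PlaneCurves.isEmpty_linearSystem fun F hF => ?_,
    fun j => PlaneCurves.exists_cubic_of_forms_insertNth_eq_bot hm (hbot j)⟩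
  have hF9 : F ∈ PlaneCurves.forms d (fun _ => m) (p ∘ Fin.succAbove 0) :=
    ⟨hF.1, fun i => hF.2 _⟩
  rcases hd.lt_or_eq with hlt | rfl
  · obtain ⟨E, -, -, -, hempty, -⟩ :=
      PlaneCurves.exists_cubic_of_forms_insertNth_eq_bot (d := d) hm (hbot 0)
    by_contra hF0
    exact (hempty hlt).false (Projectivization.mk ℂ ⟨F, hF9⟩ fun h0 => hF0 (congrArg Subtype.val h0))
  · exact (Submodule.mem_bot ℂ).1 (hbot 0 ▸
      PlaneCurves.mem_forms_insertNth.2 ⟨hF9, (hF.2 0).mono hm⟩)
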